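/- Let $n\ge 1$, $q\in\mathbb C$ with $0<|q|<1$, and $\tau\in\mathbb T_n:=\{\tau\in\mathbb C^n : 0<|\tau_1|<\cdots<|\tau_n|<1\}$. Let $W_n=\{\pm1\}^n\rtimes S_n$ act on $\mathbb Z^n$ by signed permutations, and on Laurent polynomials in $x_1,\dots,x_n$ over $\mathbb C$ by $x^\alpha\mapsto x^{w\alpha}$; a Laurent polynomial is symmetric if it is $W_n$-invariant. Put $|\alpha|=\sum_i|\alpha_i|$ for $\alpha\in\mathbb Z^n$; a Laurent polynomial has degree $\le d$ if all monomials $x^\alpha$ occurring in it satisfy $|\alpha|\le d$. Let $\Lambda_n^+=\{\lambda\in\mathbb Z^n:\lambda_1\ge\cdots\ge\lambda_n\ge0\}$, and let $\alpha^+$ be the unique element of $\Lambda_n^+\cap W_n\alpha$. Let $\pi_\alpha\in S_n$ be the unique permutation such that, for $i<j$, $\pi_\alpha^{-1}(i)<\pi_\alpha^{-1}(j)$ if and only if $|\alpha_i|>|\alpha_j|$ or $0\le\alpha_i=\pm\alpha_j$. Define $\overline\alpha=\overline\alpha(q,\tau)\in(\mathbb C^*)^n$ by $\overline\alpha_i=q^{\alpha_i}\bigl(\tau_{\pi_\alpha^{-1}(i)}\bigr)^{\mathrm{sgn}(\alpha_i)}$,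 where $\mathrm{sgn}(a)=1$ for $a\ge0$ and $\mathrm{sgn}(a)=-1$ for $a<0$ (so $\overline\mu_i=q^{\mu_i}\tau_i$ for $\mu\in\Lambda_n^+$). For $\lambda\in\Lambda_n^+$ let $R_\lambda(x)=R_\lambda(x;q,\tau)$ be the symmetric Laurent polynomial of degree $\le|\lambda|$ with $R_\lambda(\overline\lambda)=1$ and $R_\lambda(\overline\mu)=0$ for all $\mu\in\Lambda_n^+$ with $|\mu|\le|\lambda|$, $\mu\ne\lambda$. For $\alpha\in\mathbb Z^n$ let $G_\alpha(x)=G_\alpha(x;q,\tau)$ be the Laurent polynomial of degree $\le|\alpha|$ with $G_\alpha(\overline\alpha)=1$ and $G_\alpha(\overline\beta)=0$ for all $\beta\in\mathbb Z^n$ with $|\beta|\le|\alpha|$, $\beta\ne\alpha$. **Theorem.** The Laurent polynomials $R_\lambda$ and $G_\alpha$ exist and are unique, and: (a) $R_\lambda(\overline\alpha)=R_\lambda(\overline{\alpha^+})$ for all $\lambda\in\Lambda_n^+$ and $\alpha\in\mathbb Z^n$. (b) For all $\lambda\in\Lambda_n^+$, $\displaystyle R_\lambda(x)=\sum_{\beta\in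 W_n\lambda}G_\beta(x).$ (c) (Principal specialization.) Let $s,t\in\mathbb C$ with $0<|s|<1$ and, if $n>1$, $0<|t|<1$, and put $\tau_i=st^{n-i}$. Then $\tau\in\mathbb T_n$, and with $R_\lambda(x;q,s,t)$ and $G_\beta(x;q,s,t)$ denoting $R_\lambda$ and $G_\beta$ for this $\tau$, $$R_\lambda(x;q,s,t)=\sum_{\beta\in W_n\lambda}G_\beta(x;q,s,t)\qquad(\lambda\in\Lambda_n^+).$$ Let $P^*_\lambda$ be Okounkov's $BC$-type interpolation Macdonald polynomial up to normalization, that is, a Laurent polynomial of degree $\le|\lambda|$ such that $P^*_\lambda(x_1/\tau_1,\dots,x_n/\tau_n)$ is symmetric, $P^*_\lambda(q^{\lambda_1},\dots,q^{\lambda_n})\ne0$, and $P^*_\lambda(q^{\mu_1},\dots,q^{\mu_n})=0$ for all $\mu\in\Lambda_n^+$ with $|\mu|\le|\lambda|$, $\mu\neq\lambda$. Such a $P^*_\lambda$ exists, and every such $P^*_\lambda$ satisfies $$P^*_\lambda(x_1/\tau_1,\dots,x_n/\tau_n)=P^*_\lambda(q^{\lambda_1},\dots,q^{\lambda_n})\sum_{\beta\in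 W_n\lambda}G_\beta(x;q,s,t).$$ -/

import Mathlib

noncomputable section

namespace BCInterp

/-! ## Laurent polynomials in `n` variables over `ℂ` -/

/-- Laurent polynomials in `n` variables with complex coefficients: the group algebra
of `ℤⁿ`. The coefficient of the monomial `x^α` in `f` is `f.coeff α`. -/
abbrev Laurent (n : ℕ) : Type := AddMonoidAlgebra ℂ (Fin n → ℤ)

/-- The value at `x` of the monomial `x^α`. -/
def monomialAt {n : ℕ} (x : Fin n → ℂ) (α : Fin n → ℤ) : ℂ := ∏ i, x i ^ α i

/-- The value of a Laurent polynomial at a point `x` (with nonzero coordinates). -/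
def evalAt {n : ℕ} (x : Fin n → ℂ) (f : Laurent n) : ℂ :=
  f.coeff.sum fun α c => c * monomialAt x α

/-- The Laurent polynomial `f(c₁ x₁, …, cₙ xₙ)`. -/
def rescale {n : ℕ} (c : Fin n → ℂ) (f : Laurent n) : Laurent n :=
  f.coeff.sum fun α a => AddMonoidAlgebra.single α (a * monomialAt c α)

/-- The weight `|α| = |α₁| + ⋯ + |αₙ|`. -/
def weight {n : ℕ} (α : Fin n → ℤ) : ℕ := ∑ i, (α i).natAbs

/-- `f` has degree at most `d`: every monomial that occurs in `f` has weight at most `d`. -/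
def DegreeLE {n : ℕ} (d : ℕ) (f : Laurent n) : Prop :=
  ∀ α : Fin n → ℤ, f.coeff α ≠ 0 → weight α ≤ d

/-! ## The hyperoctahedral group -/

/-- The action of `Sₙ` on `{±1}ⁿ` by permutation of the coordinates. -/
def permSigns (n : ℕ) : Equiv.Perm (Fin n) →* MulAut (Fin n → ℤˣ) where
  toFun p :=
    { toFun := fun σ j => σ (p.symm j)
      invFun := fun σ j => σ (p j)
      left_inv := fun σ => by funext j; simp
      right_inv := fun σ => by funext j; simp
      map_mul' := fun _ _ => rfl }
  map_one' := rfl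
  map_mul' _ _ := rfl

/-- The Weyl group `Wₙ = {±1}ⁿ ⋊ Sₙ` of type `Bₙ`. -/
abbrev WeylB (n : ℕ) : Type := (Fin n → ℤˣ) ⋊[permSigns n] Equiv.Perm (Fin n)

/-- `Wₙ` acts on `ℤⁿ` by signed permutations: `(σπ α)_j = σ_j α_{π⁻¹(j)}`. -/
instance weylAction (n : ℕ) : MulAction (WeylB n) (Fin n → ℤ) where
  smul w α := fun j => (w.left j : ℤ) * α (w.right.symm j)
  one_smul α := by
    funext j
    change (((1 : Fin n → ℤˣ) j : ℤˣ) : ℤ) * α j = α j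
    simp
  mul_smul v w α := by
    funext j
    change ((v.left j * w.left (v.right.symm j) : ℤˣ) : ℤ) * α (w.right.symm (v.right.symm j))
      = (v.left j : ℤ) * ((w.left (v.right.symm j) : ℤ) * α (w.right.symm (v.right.symm j)))
    rw [Units.val_mul, mul_assoc]

theorem weyl_smul_apply {n : ℕ} (w : WeylB n) (α : Fin n → ℤ) (j : Fin n) :
    (w • α) j = (w.left j : ℤ) * α (w.right.symm j) := rfl

/-- `f` is symmetric: it is invariant under the action of `Wₙ` on Laurent polynomials
that sends `x^α` to `x^{wα}`. -/
def IsSymmetric {n : ℕ} (f : Laurent n) : Prop :=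
  ∀ w : WeylB n, AddMonoidAlgebra.mapDomain (fun α : Fin n → ℤ => w • α) f = f

theorem finite_weyl (n : ℕ) : Finite (WeylB n) :=
  Finite.of_equiv _ (SemidirectProduct.equivProd (φ := permSigns n)).symm

theorem finite_orbit {n : ℕ} (α : Fin n → ℤ) : (MulAction.orbit (WeylB n) α).Finite := by
  have := finite_weyl n
  exact Set.finite_range _

/-- The orbit `Wₙ α` as a finite set. -/
def orbitFinset {n : ℕ} (α : Fin n → ℤ) : Finset (Fin n → ℤ) := (finite_orbit α).toFinset

/-- Partitions of length at most `n`: `λ₁ ≥ ⋯ ≥ λₙ ≥ 0`. -/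
def IsPartition {n : ℕ} (lam : Fin n → ℤ) : Prop := Antitone lam ∧ ∀ i, 0 ≤ lam i

/-! ## The permutation `π_α` and the dominant representative `α⁺` -/

/-- The indices `1, …, n` are ordered by decreasing `|α_i|`; among equal absolute values
the nonnegative entries come first, with increasing index, followed by the
negative entries, with decreasing index. -/
def sortKey {n : ℕ} (α : Fin n → ℤ) (i : Fin n) : ℤ ×ₗ ℤ :=
  toLex (-|α i|, if 0 ≤ α i then (i : ℤ) else 2 * n - i)

/-- The permutation `π_α` that lists the indices in the order given by `sortKey`. -/
def sortPerm {n : ℕ} (α : Fin n → ℤ) : Equiv.Perm (Fin n) := Tuple.sort (sortKey α)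

/-- The partition `α⁺` in the orbit `Wₙ α`. -/
def domRep {n : ℕ} (α : Fin n → ℤ) : Fin n → ℤ := fun j => |α (sortPerm α j)|

theorem sortKey_injective {n : ℕ} (α : Fin n → ℤ) : Function.Injective (sortKey α) := by
  intro i j h
  have h' := toLex.injective h
  simp only [Prod.mk.injEq] at h'
  obtain ⟨_, h2⟩ := h'
  have hi := i.isLt
  have hj := j.isLt
  apply Fin.ext
  split_ifs at h2 <;> omega

/-- The property that characterizes `π_α`. -/
theorem sortPerm_symm_lt_iff {n : ℕ} (α : Fin n → ℤ) {i j : Fin n} (hij : i < j) :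
    (sortPerm α).symm i < (sortPerm α).symm j ↔
      |α j| < |α i| ∨ (0 ≤ α i ∧ (α i = α j ∨ α i = -α j)) := by
  have hmono : StrictMono (sortKey α ∘ sortPerm α) :=
    (Tuple.monotone_sort (sortKey α)).strictMono_of_injective
      ((sortKey_injective α).comp (sortPerm α).injective)
  rw [← hmono.lt_iff_lt]
  simp only [Function.comp_apply, Equiv.apply_symm_apply, sortKey, Prod.Lex.toLex_lt_toLex]
  have hi := i.isLt
  have hj := j.isLt
  have hij' : (i : ℕ) < j := hij
  rcases abs_cases (α i) with ⟨h1, h2⟩ | ⟨h1, h2⟩ <;>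
    rcases abs_cases (α j) with ⟨h3, h4⟩ | ⟨h3, h4⟩ <;>
    rw [h1, h3] <;> split_ifs <;> omega

theorem isPartition_domRep {n : ℕ} (α : Fin n → ℤ) : IsPartition (domRep α) := by
  refine ⟨fun i j hij => ?_, fun i => abs_nonneg _⟩
  have h : sortKey α (sortPerm α i) ≤ sortKey α (sortPerm α j) :=
    Tuple.monotone_sort (sortKey α) hij
  simp only [sortKey, Prod.Lex.toLex_le_toLex] at h
  simp only [domRep]
  omega

theorem domRep_mem_orbit {n : ℕ} (α : Fin n → ℤ) : domRep α ∈ MulAction.orbit (WeylB n) α := by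
  refine ⟨⟨fun j => if 0 ≤ α (sortPerm α j) then 1 else -1, (sortPerm α).symm⟩, ?_⟩
  funext j
  change ((if 0 ≤ α (sortPerm α j) then (1 : ℤˣ) else -1 : ℤˣ) : ℤ) * α (sortPerm α j) = _
  simp only [domRep]
  split_ifs with h
  · simp [abs_of_nonneg h]
  · simp [abs_of_neg (not_le.mp h)]

theorem eq_domRep_of_mem_orbit {n : ℕ} (α μ : Fin n → ℤ) (hμ : IsPartition μ)
    (h : μ ∈ MulAction.orbit (WeylB n) α) : μ = domRep α := by
  obtain ⟨w, rfl⟩ := h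
  have key : (w • α) = (fun i => |α i|) ∘ w.right.symm := by
    funext j
    have h0 : 0 ≤ (w • α) j := hμ.2 j
    rw [Function.comp_apply, ← abs_of_nonneg h0]
    change |(w.left j : ℤ) * α (w.right.symm j)| = _
    rcases Int.units_eq_one_or (w.left j) with hw | hw <;> simp [hw]
  have h1 : Antitone ((fun i => |α i|) ∘ w.right.symm) := key ▸ hμ.1
  have h2 : Antitone ((fun i => |α i|) ∘ sortPerm α) := (isPartition_domRep α).1
  exact key.trans (Tuple.unique_antitone h1 h2)

/-! ## Interpolation points -/

/-- The parameters `τ` with `0 < |τ₁| < ⋯ < |τₙ| < 1`. -/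
def paramSet (n : ℕ) : Set (Fin n → ℂ) :=
  {τ | (∀ i, 0 < ‖τ i‖) ∧ StrictMono (fun i => ‖τ i‖) ∧ ∀ i, ‖τ i‖ < 1}

/-- The interpolation point of `α`: its `i`-th coordinate is
`q^{α_i} (τ_{π_α⁻¹(i)})^{sgn(α_i)}`, with `sgn(a) = 1` if `a ≥ 0` and `sgn(a) = -1` if `a < 0`. -/
def interpPoint {n : ℕ} (q : ℂ) (τ : Fin n → ℂ) (α : Fin n → ℤ) : Fin n → ℂ := fun i =>
  q ^ α i * τ ((sortPerm α).symm i) ^ (if 0 ≤ α i then (1 : ℤ) else -1)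

theorem interpPoint_of_isPartition {n : ℕ} (q : ℂ) (τ : Fin n → ℂ) {μ : Fin n → ℤ}
    (hμ : IsPartition μ) (i : Fin n) : interpPoint q τ μ i = q ^ μ i * τ i := by
  have h : sortPerm μ = Equiv.refl _ := by
    refine Tuple.sort_eq_refl_iff_monotone.mpr fun a b hab => ?_
    have h1 := hμ.1 hab
    have h2 := hμ.2 a
    have h3 := hμ.2 b
    have hab' : (a : ℕ) ≤ b := hab
    simp only [sortKey, Prod.Lex.toLex_le_toLex, abs_of_nonneg h2, abs_of_nonneg h3,
      if_pos h2, if_pos h3]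
    omega
  simp [interpPoint, h, if_pos (hμ.2 i)]

/-! ## Interpolation Laurent polynomials -/

/-- The defining properties of the symmetric interpolation Laurent polynomial of a
partition `lam`. -/
def IsSymInterp {n : ℕ} (q : ℂ) (τ : Fin n → ℂ) (lam : Fin n → ℤ) (f : Laurent n) : Prop :=
  IsSymmetric f ∧ DegreeLE (weight lam) f ∧ evalAt (interpPoint q τ lam) f = 1 ∧
    ∀ μ : Fin n → ℤ, IsPartition μ → weight μ ≤ weight lam → μ ≠ lam →
      evalAt (interpPoint q τ μ) f = 0

/-- The defining properties of the nonsymmetric interpolation Laurent polynomial of `α ∈ ℤⁿ`. -/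
def IsNonsymInterp {n : ℕ} (q : ℂ) (τ : Fin n → ℂ) (α : Fin n → ℤ) (g : Laurent n) : Prop :=
  DegreeLE (weight α) g ∧ evalAt (interpPoint q τ α) g = 1 ∧
    ∀ β : Fin n → ℤ, weight β ≤ weight α → β ≠ α → evalAt (interpPoint q τ β) g = 0

/-- The symmetric interpolation Laurent polynomial `R_lam(x; q, τ)`. -/
def symInterp {n : ℕ} (q : ℂ) (τ : Fin n → ℂ) (lam : Fin n → ℤ) : Laurent n :=
  Classical.epsilon (IsSymInterp q τ lam)

/-- The nonsymmetric interpolation Laurent polynomial `G_α(x; q, τ)`. -/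
def nonsymInterp {n : ℕ} (q : ℂ) (τ : Fin n → ℂ) (α : Fin n → ℤ) : Laurent n :=
  Classical.epsilon (IsNonsymInterp q τ α)

/-! ## The principal specialization -/

/-- The principal specialization `τ_i = s t^{n-i}`, `i = 1, …, n` (indices in `Fin n`
start at `0`). -/
def principalSpec (n : ℕ) (s t : ℂ) : Fin n → ℂ := fun i => s * t ^ (n - 1 - (i : ℕ))

/-- `P` is a `BC`-type interpolation Macdonald polynomial of the partition `lam`, in
Okounkov's variables and up to normalization: `P` has degree at most `|lam|`, it becomes symmetric
when it is written in the variables `s t^{n-i} x_i`, and it vanishes at `q^μ` for all partitions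
`μ ≠ lam` with `|μ| ≤ |lam|`, but not at `q^lam`. -/
def IsOkounkov {n : ℕ} (q s t : ℂ) (lam : Fin n → ℤ) (P : Laurent n) : Prop :=
  DegreeLE (weight lam) P ∧
    IsSymmetric (rescale (fun i => (principalSpec n s t i)⁻¹) P) ∧
    evalAt (fun i => q ^ lam i) P ≠ 0 ∧
    ∀ μ : Fin n → ℤ, IsPartition μ → weight μ ≤ weight lam → μ ≠ lam →
      evalAt (fun i => q ^ μ i) P = 0

end BCInterp

end

open BCInterp

noncomputable section

namespace BCInterp

/-! ## Evaluation as a ring homomorphism -/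

/-! Everything rests on one fact: on Laurent polynomials of degree ≤ d, the values at the points ᾱ
with |α| ≤ d can be prescribed arbitrarily (`exists_interpolation`). There are as many points as
monomials, so these values also determine the polynomial (`eq_of_evalAt_eq`).

To prescribe values, take for each α a product of factors x_i^{±1} - c, with i an index and b
running over the integers before α_i in the order 0, -1, 1, -2, 2, …. The pairs (b, i) are listed in
the reverse of the order defining π_α, so ᾱ_i^{sgn α_i} is q^{|α_i|} times the parameter selected by
the number of pairs (α_l, l) listed before (α_i, i). The constant c is formed by the same rule from
(b, i) and α. If (β_i, i) is the first pair at which the sets of pairs of α and β differ, the rule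
gives the same constant for both, and the factor of (β_i, i) vanishes at β̄
(`evalAt_newton_eq_zero`). A comparison of norms shows that the polynomial of α does not vanish at ᾱ
(`evalAt_newton_self_ne_zero`). The evaluation matrix is therefore triangular and invertible.

For the symmetric case, the coordinates of ᾱ are those of the point of α⁺, permuted and some of them
inverted. This gives (a), and shows that values at partitions determine a symmetric polynomial;
counting orbit sums gives existence. Both sides of (b) take the value 1 on the orbit of λ and 0 at
all other points of weight ≤ |λ|. Part (c) is this for one τ, and Okounkov's polynomials are
multiples of R_λ after rescaling by τ. -/

theorem monomialAt_zero {n : ℕ} (x : Fin n → ℂ) : monomialAt x 0 = 1 := by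
  simp [monomialAt]

theorem monomialAt_add {n : ℕ} {x : Fin n → ℂ} (hx : ∀ i, x i ≠ 0) (α β : Fin n → ℤ) :
    monomialAt x (α + β) = monomialAt x α * monomialAt x β := by
  simp only [monomialAt, Pi.add_apply, ← Finset.prod_mul_distrib]
  exact Finset.prod_congr rfl fun i _ => zpow_add₀ (hx i) _ _

theorem monomialAt_single {n : ℕ} (x : Fin n → ℂ) (i : Fin n) (k : ℤ) :
    monomialAt x (Pi.single i k) = x i ^ k := by
  rw [monomialAt, Finset.prod_eq_single i]
  · simp
  · intro j _ hj
    simp [Pi.single_eq_of_ne hj]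
  · simp

theorem monomialAt_mul {n : ℕ} (x y : Fin n → ℂ) (α : Fin n → ℤ) :
    monomialAt (fun i => x i * y i) α = monomialAt x α * monomialAt y α := by
  simp only [monomialAt, mul_zpow, Finset.prod_mul_distrib]

/-- Evaluation at a point with nonzero coordinates, as an algebra homomorphism. -/
def evalHom {n : ℕ} (x : Fin n → ℂ) (hx : ∀ i, x i ≠ 0) : Laurent n →ₐ[ℂ] ℂ :=
  AddMonoidAlgebra.lift ℂ ℂ (Fin n → ℤ)
    { toFun := fun α => monomialAt x α.toAdd
      map_one' := monomialAt_zero x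
      map_mul' := fun α β => monomialAt_add hx α.toAdd β.toAdd }

theorem evalHom_apply {n : ℕ} (x : Fin n → ℂ) (hx : ∀ i, x i ≠ 0) (f : Laurent n) :
    evalHom x hx f = evalAt x f := by
  rw [evalHom, AddMonoidAlgebra.lift_apply]
  rfl

/-- Evaluation at an arbitrary point, as a linear map. -/
def evalLin {n : ℕ} (x : Fin n → ℂ) : Laurent n →ₗ[ℂ] ℂ where
  toFun := evalAt x
  map_add' f g := by
    simp only [evalAt, AddMonoidAlgebra.coeff_add]
    exact Finsupp.sum_add_index' (by simp) fun _ _ _ => add_mul _ _ _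
  map_smul' a f := by
    simp only [evalAt, AddMonoidAlgebra.coeff_smul, RingHom.id_apply, smul_eq_mul]
    rw [Finsupp.sum_smul_index' (by simp), Finsupp.mul_sum]
    exact Finsupp.sum_congr fun _ _ => by rw [smul_eq_mul, mul_assoc]

theorem evalAt_single {n : ℕ} (x : Fin n → ℂ) (α : Fin n → ℤ) (c : ℂ) :
    evalAt x (AddMonoidAlgebra.single α c) = c * monomialAt x α := by
  simp [evalAt]

theorem evalAt_sum {n : ℕ} {ι : Type*} (x : Fin n → ℂ) (s : Finset ι) (f : ι → Laurent n) :
    evalAt x (∑ i ∈ s, f i) = ∑ i ∈ s, evalAt x (f i) :=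
  map_sum (evalLin x) f s

theorem evalAt_smul {n : ℕ} (x : Fin n → ℂ) (c : ℂ) (f : Laurent n) :
    evalAt x (c • f) = c * evalAt x f :=
  map_smul (evalLin x) c f

theorem evalAt_sub {n : ℕ} (x : Fin n → ℂ) (f g : Laurent n) :
    evalAt x (f - g) = evalAt x f - evalAt x g :=
  map_sub (evalLin x) f g

theorem evalAt_prod {n : ℕ} {ι : Type*} {x : Fin n → ℂ} (hx : ∀ i, x i ≠ 0) (s : Finset ι)
    (f : ι → Laurent n) : evalAt x (∏ i ∈ s, f i) = ∏ i ∈ s, evalAt x (f i) := by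
  simp only [← evalHom_apply x hx, map_prod]

theorem evalAt_mapDomain {n : ℕ} (x : Fin n → ℂ) (φ : (Fin n → ℤ) → Fin n → ℤ) (f : Laurent n) :
    evalAt x (AddMonoidAlgebra.mapDomain φ f) = f.coeff.sum fun α c => c * monomialAt x (φ α) :=
  Finsupp.sum_mapDomain_index (by simp) fun _ _ _ => add_mul _ _ _

/-! ## Degree -/

/-- The Laurent polynomials of degree at most `d`. -/
def degreeLE (n d : ℕ) : Submodule ℂ (Laurent n) where
  carrier := {f | DegreeLE d f}
  zero_mem' := fun α h => (h rfl).elim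
  add_mem' := fun {f g} hf hg α h => by
    by_cases hα : f.coeff α = 0
    · refine hg α fun h' => h ?_
      rw [AddMonoidAlgebra.coeff_add, Finsupp.add_apply, hα, h', add_zero]
    · exact hf α hα
  smul_mem' := fun c f hf α h => by
    refine hf α fun h' => h ?_
    rw [AddMonoidAlgebra.coeff_smul, Finsupp.smul_apply, h', smul_zero]

theorem mem_degreeLE {n d : ℕ} {f : Laurent n} : f ∈ degreeLE n d ↔ DegreeLE d f := Iff.rfl

theorem degreeLE_single {n d : ℕ} {α : Fin n → ℤ} (h : weight α ≤ d) (c : ℂ) :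
    DegreeLE d (AddMonoidAlgebra.single α c) := by
  intro β hβ
  rw [AddMonoidAlgebra.coeff_single, Finsupp.single_apply] at hβ
  split_ifs at hβ with hαβ
  · exact hαβ ▸ h
  · exact (hβ rfl).elim

theorem DegreeLE.mono {n d e : ℕ} {f : Laurent n} (hf : DegreeLE d f) (h : d ≤ e) :
    DegreeLE e f := fun α hα => (hf α hα).trans h

theorem finite_weight_le (n d : ℕ) : {α : Fin n → ℤ | weight α ≤ d}.Finite := by
  refine (Set.finite_Icc (fun _ => -(d : ℤ)) (fun _ => (d : ℤ))).subset fun α hα => ?_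
  have h : ∀ i, (α i).natAbs ≤ d := fun i =>
    (Finset.single_le_sum (f := fun i => (α i).natAbs) (fun _ _ => Nat.zero_le _)
      (Finset.mem_univ i)).trans hα
  exact ⟨fun i => by have := h i; simp only; omega, fun i => by have := h i; simp only; omega⟩

/-- The exponents of weight at most `d`. -/
def weightLE (n d : ℕ) : Finset (Fin n → ℤ) := (finite_weight_le n d).toFinset

theorem mem_weightLE {n d : ℕ} {α : Fin n → ℤ} : α ∈ weightLE n d ↔ weight α ≤ d := by
  simp [weightLE]

theorem eq_sum_single {n d : ℕ} {f : Laurent n} (hf : DegreeLE d f) :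
    f = ∑ α ∈ weightLE n d, AddMonoidAlgebra.single α (f.coeff α) := by
  refine AddMonoidAlgebra.ext (Finsupp.ext fun β => ?_)
  rw [AddMonoidAlgebra.coeff_sum, Finsupp.finsetSum_apply]
  simp only [AddMonoidAlgebra.coeff_single, Finsupp.single_apply, Finset.sum_ite_eq',
    mem_weightLE]
  split_ifs with h
  · rfl
  · exact not_not.mp fun h' => h (hf β h')

/-- All exponents of `f` lie between `lo` and `hi`. -/
def InBox {n : ℕ} (lo hi : Fin n → ℤ) (f : Laurent n) : Prop :=
  ∀ α : Fin n → ℤ, f.coeff α ≠ 0 → lo ≤ α ∧ α ≤ hi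

theorem inBox_one {n : ℕ} : InBox 0 0 (1 : Laurent n) := by
  intro α hα
  rw [AddMonoidAlgebra.one_def, AddMonoidAlgebra.coeff_single, Finsupp.single_apply] at hα
  split_ifs at hα with h
  · exact ⟨h.le, h.ge⟩
  · exact (hα rfl).elim

theorem InBox.mul {n : ℕ} {a b c d : Fin n → ℤ} {f g : Laurent n} (hf : InBox a b f)
    (hg : InBox c d g) : InBox (a + c) (b + d) (f * g) := by
  classical
  intro α hα
  have h := AddMonoidAlgebra.support_coeff_mul_subset f g (Finsupp.mem_support_iff.mpr hα)
  obtain ⟨β, hβ, γ, hγ, rfl⟩ := Finset.mem_add.mp h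
  have h1 := hf β (Finsupp.mem_support_iff.mp hβ)
  have h2 := hg γ (Finsupp.mem_support_iff.mp hγ)
  exact ⟨add_le_add h1.1 h2.1, add_le_add h1.2 h2.2⟩

theorem InBox.prod {n : ℕ} {ι : Type*} (s : Finset ι) {lo hi : ι → Fin n → ℤ}
    {f : ι → Laurent n} (h : ∀ i ∈ s, InBox (lo i) (hi i) (f i)) :
    InBox (∑ i ∈ s, lo i) (∑ i ∈ s, hi i) (∏ i ∈ s, f i) := by
  classical
  induction s using Finset.induction_on with
  | empty => simpa using inBox_one
  | insert i s hi ih =>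
    rw [Finset.sum_insert hi, Finset.sum_insert hi, Finset.prod_insert hi]
    exact (h i (Finset.mem_insert_self i s)).mul
      (ih fun j hj => h j (Finset.mem_insert_of_mem hj))

theorem InBox.degreeLE {n : ℕ} {lo hi α : Fin n → ℤ} {f : Laurent n} (hf : InBox lo hi f)
    (hlo : ∀ i, -|α i| ≤ lo i) (hhi : ∀ i, hi i ≤ |α i|) : DegreeLE (weight α) f := by
  intro β hβ
  obtain ⟨h1, h2⟩ := hf β hβ
  refine Finset.sum_le_sum fun i _ => ?_
  have h3 := (hlo i).trans (h1 i)
  have h4 := (h2 i).trans (hhi i)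
  rw [Int.abs_eq_natAbs] at h3 h4
  change (β i).natAbs ≤ (α i).natAbs
  zify
  rw [abs_le]
  simpa only [Int.abs_eq_natAbs] using ⟨h3,h4⟩

/-! ## A Newton basis

The integers are enumerated as `0, -1, 1, -2, 2, …`; the pairs `(b, i)` of an integer and an index
are enumerated by `stage`, in decreasing order of the keys that define `sortPerm`. -/

/-- The position of the pair `(b, i)` in the enumeration. -/
def stage {n : ℕ} (b : ℤ) (i : Fin n) : ℕ :=
  2 * n * b.natAbs + if 0 ≤ b then 2 * n - 1 - i else i

/-- Each absolute value owns a block of 2n stages: negative integers use the first half with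
increasing index, nonnegative ones the second half with decreasing index. -/
theorem stage_inj {n : ℕ} {a b : ℤ} {i j : Fin n} (h : stage a i = stage b j) :
    a = b ∧ i = j := by
  have hi := i.isLt
  have hj := j.isLt
  have key : a.natAbs = b.natAbs := by
    simp only [stage] at h
    rcases lt_trichotomy a.natAbs b.natAbs with h' | h' | h'
    · have := Nat.mul_le_mul_left (2 * n) (Nat.succ_le_of_lt h')
      rw [Nat.mul_succ] at this
      split_ifs at h <;> omega
    · exact h'
    · have := Nat.mul_le_mul_left (2 * n) (Nat.succ_le_of_lt h')
      rw [Nat.mul_succ] at this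
      split_ifs at h <;> omega
  simp only [stage, key] at h
  refine ⟨?_, Fin.ext ?_⟩ <;> split_ifs at h <;> omega

theorem stage_lt_iff {n : ℕ} (α : Fin n → ℤ) (i j : Fin n) :
    stage (α i) i < stage (α j) j ↔ sortKey α j < sortKey α i := by
  have hi := i.isLt
  have hj := j.isLt
  simp only [stage, sortKey, Prod.Lex.toLex_lt_toLex, Int.abs_eq_natAbs]
  rcases lt_trichotomy (α i).natAbs (α j).natAbs with h' | h' | h'
  · have := Nat.mul_le_mul_left (2 * n) (Nat.succ_le_of_lt h')
    rw [Nat.mul_succ] at this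
    split_ifs <;> omega
  · rw [h']
    split_ifs <;> omega
  · have := Nat.mul_le_mul_left (2 * n) (Nat.succ_le_of_lt h')
    rw [Nat.mul_succ] at this
    split_ifs <;> omega

/-- The integers that precede `a` in the enumeration `0, -1, 1, -2, 2, …`. -/
def before (a : ℤ) : Finset ℤ := if 0 ≤ a then Finset.Ico (-a) a else Finset.Ioo a (-a)

theorem mem_before_iff {n : ℕ} {a b : ℤ} (i : Fin n) :
    b ∈ before a ↔ stage b i < stage a i := by
  have hi := i.isLt
  simp only [before, stage]
  rcases lt_trichotomy a.natAbs b.natAbs with h' | h' | h'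
  · have := Nat.mul_le_mul_left (2 * n) (Nat.succ_le_of_lt h')
    rw [Nat.mul_succ] at this
    split_ifs <;> simp only [Finset.mem_Ico, Finset.mem_Ioo] <;> omega
  · rw [h']
    split_ifs <;> simp only [Finset.mem_Ico, Finset.mem_Ioo] <;> omega
  · have := Nat.mul_le_mul_left (2 * n) (Nat.succ_le_of_lt h')
    rw [Nat.mul_succ] at this
    split_ifs <;> simp only [Finset.mem_Ico, Finset.mem_Ioo] <;> omega

/-- The number of pairs `(α_l, l)` that precede `s` in the enumeration. -/
def countBefore {n : ℕ} (α : Fin n → ℤ) (s : ℕ) : ℕ :=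
  (Finset.univ.filter fun l => stage (α l) l < s).card

theorem countBefore_mono {n : ℕ} (α : Fin n → ℤ) {s t : ℕ} (h : s ≤ t) :
    countBefore α s ≤ countBefore α t :=
  Finset.card_le_card fun l hl => by
    simp only [Finset.mem_filter, Finset.mem_univ, true_and] at hl ⊢
    omega

theorem countBefore_stage {n : ℕ} (α : Fin n → ℤ) (i : Fin n) :
    countBefore α (stage (α i) i) = n - 1 - ((sortPerm α).symm i : ℕ) := by
  have hmono : StrictMono (sortKey α ∘ sortPerm α) :=
    (Tuple.monotone_sort (sortKey α)).strictMono_of_injective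
      ((sortKey_injective α).comp (sortPerm α).injective)
  -- The pairs listed before that of i belong to the indices placed after i by π_α, that is, to the
  -- image under π_α of the positions beyond π_α⁻¹(i).
  rw [countBefore, ← Fin.card_Ioi, 
    ← Finset.card_map (s := Finset.Ioi _) (sortPerm α).toEmbedding]
  congr 1
  ext l
  simp only [Finset.mem_filter, Finset.mem_univ, true_and, stage_lt_iff, Finset.mem_map_equiv,
    Finset.mem_Ioi]
  rw [← hmono.lt_iff_lt]
  simp

/-- The parameter with `k` larger parameters. -/
def paramRev {n : ℕ} (τ : Fin n → ℂ) (k : ℕ) : ℂ :=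
  if h : n - 1 - k < n then τ ⟨n - 1 - k, h⟩ else 1

theorem paramRev_countBefore {n : ℕ} (τ : Fin n → ℂ) (α : Fin n → ℤ) (i : Fin n) :
    paramRev τ (countBefore α (stage (α i) i)) = τ ((sortPerm α).symm i) := by
  have h := ((sortPerm α).symm i).isLt
  have h' : n - 1 - (n - 1 - ((sortPerm α).symm i : ℕ)) = (sortPerm α).symm i := by omega
  simp only [paramRev, countBefore_stage, h', Fin.is_lt, dif_pos]

/-- `sgn b`, with `sgn 0 = 1`. -/
def sgn (b : ℤ) : ℤ := if 0 ≤ b then 1 else -1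

theorem interpPoint_apply {n : ℕ} (q : ℂ) (τ : Fin n → ℂ) (α : Fin n → ℤ) (i : Fin n) :
    interpPoint q τ α i = (q ^ (α i).natAbs * τ ((sortPerm α).symm i)) ^ sgn (α i) := by
  rw [interpPoint, sgn]
  split_ifs with h
  · rw [zpow_one, zpow_one, ← zpow_natCast, Int.natAbs_of_nonneg h]
  · rw [zpow_neg_one, zpow_neg_one, mul_inv, ← zpow_natCast, ← zpow_neg]
    congr 2
    omega

theorem sgn_mul_self (b : ℤ) : sgn b * sgn b = 1 := by
  rw [sgn]
  split_ifs <;> rfl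

/-- The value at `(b, i)` at which the Newton polynomial of `α` vanishes. -/
def newtonNode {n : ℕ} (q : ℂ) (τ : Fin n → ℂ) (α : Fin n → ℤ) (b : ℤ) (i : Fin n) : ℂ :=
  q ^ b.natAbs * paramRev τ (countBefore α (stage b i))

/-- Ties the points to the nodes: beyond the pair (α_i, i) itself, this coordinate sees α only
through the count of earlier pairs. -/
theorem interpPoint_zpow_sgn {n : ℕ} (q : ℂ) (τ : Fin n → ℂ) (α : Fin n → ℤ) (i : Fin n) :
    interpPoint q τ α i ^ sgn (α i) = newtonNode q τ α (α i) i := by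
  rw [interpPoint_apply, ← zpow_mul, sgn_mul_self, zpow_one, newtonNode, paramRev_countBefore]

/-- The Newton polynomial of `α`. -/
def newton {n : ℕ} (q : ℂ) (τ : Fin n → ℂ) (α : Fin n → ℤ) : Laurent n :=
  ∏ i, ∏ b ∈ before (α i), (AddMonoidAlgebra.single (Pi.single i (sgn b)) 1 -
    AddMonoidAlgebra.single 0 (newtonNode q τ α b i))

theorem evalAt_newton {n : ℕ} (q : ℂ) (τ : Fin n → ℂ) (α : Fin n → ℤ) {x : Fin n → ℂ}
    (hx : ∀ i, x i ≠ 0) : evalAt x (newton q τ α) =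
      ∏ i, ∏ b ∈ before (α i), (x i ^ sgn b - newtonNode q τ α b i) := by
  simp only [newton, evalAt_prod hx, evalAt_sub, evalAt_single, monomialAt_single,
    monomialAt_zero, one_mul, mul_one]

/-! ### Degree bound for the Newton polynomials -/

theorem sum_before_pos (a : ℤ) : ∑ b ∈ before a, max (sgn b) 0 ≤ |a| := by
  have h1 : ∀ b, max (sgn b) 0 = if 0 ≤ b then 1 else 0 := fun b => by
    rw [sgn]
    split_ifs <;> rfl
  simp only [h1, Finset.sum_boole]
  have h2 : (before a).filter (0 ≤ ·) ⊆ Finset.Ico 0 |a| := fun b hb => by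
    rw [Finset.mem_filter, before] at hb
    rw [Finset.mem_Ico]
    split_ifs at hb with h
    · rw [abs_of_nonneg h]
      exact ⟨hb.2, (Finset.mem_Ico.mp hb.1).2⟩
    · rw [abs_of_neg (not_le.mp h)]
      exact ⟨hb.2, (Finset.mem_Ioo.mp hb.1).2⟩
  have h3 := Finset.card_le_card h2
  rw [Int.card_Ico, sub_zero] at h3
  have h4 := abs_nonneg a
  omega

theorem sum_before_neg (a : ℤ) : -|a| ≤ ∑ b ∈ before a, min (sgn b) 0 := by
  have h1 : ∀ b, min (sgn b) 0 = -if b < 0 then 1 else 0 := fun b => by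
    rw [sgn]
    split_ifs <;> first | rfl | omega
  simp only [h1, Finset.sum_neg_distrib, Finset.sum_boole]
  have h2 : (before a).filter (· < 0) ⊆ Finset.Ico (-|a|) 0 := fun b hb => by
    rw [Finset.mem_filter, before] at hb
    rw [Finset.mem_Ico]
    split_ifs at hb with h
    · rw [abs_of_nonneg h]
      exact ⟨(Finset.mem_Ico.mp hb.1).1, hb.2⟩
    · rw [abs_of_neg (not_le.mp h), neg_neg]
      exact ⟨(Finset.mem_Ioo.mp hb.1).1.le, hb.2⟩
  have h3 := Finset.card_le_card h2
  rw [Int.card_Ico, zero_sub, neg_neg] at h3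
  have h4 := abs_nonneg a
  omega

theorem inBox_factor {n : ℕ} (i : Fin n) (k : ℤ) (c : ℂ) :
    InBox (Pi.single i (min k 0)) (Pi.single i (max k 0))
      (AddMonoidAlgebra.single (Pi.single i k) 1 - AddMonoidAlgebra.single 0 c : Laurent n) := by
  intro α hα
  have h : α = Pi.single i k ∨ α = Pi.single i 0 := by
    by_contra! h
    refine hα ?_
    rw [AddMonoidAlgebra.coeff_sub, Finsupp.sub_apply, AddMonoidAlgebra.coeff_single,
      AddMonoidAlgebra.coeff_single, Finsupp.single_apply, Finsupp.single_apply,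
      if_neg h.1.symm, if_neg fun h' => h.2 (by rw [← h', Pi.single_zero]), sub_zero]
  rcases h with rfl | rfl
  · exact ⟨Pi.single_mono i (min_le_left _ _), Pi.single_mono i (le_max_left _ _)⟩
  · exact ⟨Pi.single_mono i (min_le_right _ _), Pi.single_mono i (le_max_right _ _)⟩

/-- Merely counting factors would give a bound near 2|α|. But at most |α_i| factors involve x_i and
at most |α_i| involve x_i⁻¹, so the exponent of x_i stays in [-|α_i|, |α_i|]; this is why boxes are
used. -/
theorem degreeLE_newton {n : ℕ} (q : ℂ) (τ : Fin n → ℂ) (α : Fin n → ℤ) :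
    DegreeLE (weight α) (newton q τ α) := by
  refine (InBox.prod Finset.univ fun i _ =>
    InBox.prod (before (α i)) fun b _ => inBox_factor i (sgn b) _).degreeLE ?_ ?_
  · intro j
    rw [Finset.sum_apply, Finset.sum_eq_single j]
    · simpa using sum_before_neg (α j)
    · intro i _ hij
      simp [Pi.single_eq_of_ne hij.symm]
    · simp
  · intro j
    rw [Finset.sum_apply, Finset.sum_eq_single j]
    · simpa using sum_before_pos (α j)
    · intro i _ hij
      simp [Pi.single_eq_of_ne hij.symm]
    · simp

/-! ## Triangularity -/

theorem param_ne_zero {n : ℕ} {τ : Fin n → ℂ} (hτ : τ ∈ paramSet n) (i : Fin n) : τ i ≠ 0 :=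
  norm_pos_iff.mp (hτ.1 i)

theorem interpPoint_ne_zero {n : ℕ} {q : ℂ} (hq : q ≠ 0) {τ : Fin n → ℂ} (hτ : τ ∈ paramSet n)
    (α : Fin n → ℤ) (i : Fin n) : interpPoint q τ α i ≠ 0 :=
  mul_ne_zero (zpow_ne_zero _ hq) (zpow_ne_zero _ (param_ne_zero hτ _))

theorem norm_paramRev_le {n : ℕ} {τ : Fin n → ℂ} (hτ : τ ∈ paramSet n) {k l : ℕ} (h : k ≤ l)
    (hn : 0 < n) : ‖paramRev τ l‖ ≤ ‖paramRev τ k‖ := by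
  rw [paramRev, paramRev, dif_pos (by omega), dif_pos (by omega)]
  exact hτ.2.1.monotone (Fin.mk_le_mk.mpr (by omega))

/-- Truncated subtraction sends every k ≥ n to the index 0, so for n > 0 the default value 1 is
never used and no bound on k is needed. -/
theorem norm_paramRev {n : ℕ} {τ : Fin n → ℂ} (hτ : τ ∈ paramSet n) (k : ℕ)
    (hn : 0 < n) : 0 < ‖paramRev τ k‖ ∧ ‖paramRev τ k‖ < 1 := by
  rw [paramRev, dif_pos (by omega)]
  exact ⟨hτ.1 _, hτ.2.2 _⟩

theorem norm_newtonNode {n : ℕ} {q : ℂ} (hq0 : 0 < ‖q‖) (hq1 : ‖q‖ < 1) {τ : Fin n → ℂ}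
    (hτ : τ ∈ paramSet n) (α : Fin n → ℤ) (b : ℤ) (i : Fin n) :
    0 < ‖newtonNode q τ α b i‖ ∧ ‖newtonNode q τ α b i‖ < 1 := by
  obtain ⟨h1, h2⟩ := norm_paramRev hτ (countBefore α (stage b i)) i.pos
  rw [newtonNode, norm_mul, norm_pow]
  exact ⟨mul_pos (pow_pos hq0 _) h1,
    mul_lt_one_of_nonneg_of_lt_one_right (pow_le_one₀ hq0.le hq1.le) h1.le h2⟩

theorem evalAt_newton_self_ne_zero {n : ℕ} {q : ℂ} (hq0 : 0 < ‖q‖) (hq1 : ‖q‖ < 1)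
    {τ : Fin n → ℂ} (hτ : τ ∈ paramSet n) (α : Fin n → ℤ) :
    evalAt (interpPoint q τ α) (newton q τ α) ≠ 0 := by
  rw [evalAt_newton q τ α (interpPoint_ne_zero (norm_pos_iff.mp hq0) hτ α)]
  refine Finset.prod_ne_zero_iff.mpr fun i _ => Finset.prod_ne_zero_iff.mpr fun b hb => ?_
  rw [sub_ne_zero]
  intro h
  have hnorm := congrArg norm h
  have hα := norm_newtonNode hq0 hq1 hτ α (α i) i
  have hβ := norm_newtonNode hq0 hq1 hτ α b i
  by_cases hs : sgn b = sgn (α i)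
  -- Equal signs: b has the smaller absolute value and at most as many pairs before it, so its node
  -- is strictly larger in norm.
  · rw [hs, interpPoint_zpow_sgn, newtonNode, newtonNode, norm_mul, norm_mul, norm_pow,
      norm_pow] at hnorm
    refine hnorm.not_lt ?_
    have hlt : b.natAbs < (α i).natAbs := by
      simp only [sgn, before] at hs hb
      split_ifs at hs hb <;> simp only [Finset.mem_Ico, Finset.mem_Ioo] at hb <;> omega
    exact mul_lt_mul (pow_lt_pow_right_of_lt_one₀ hq0 hq1 hlt)
      (norm_paramRev_le hτ (countBefore_mono α ((mem_before_iff i).mp hb).le) i.pos)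
      (norm_paramRev hτ _ i.pos).1 (pow_nonneg hq0.le _)
  -- Opposite signs: the coordinate is the inverse of a node, of norm > 1, while the node of b has
  -- norm < 1.
  · have hs' : sgn b = -sgn (α i) := by
      simp only [sgn] at hs ⊢
      split_ifs at hs ⊢ <;> omega
    rw [hs', zpow_neg, interpPoint_zpow_sgn, norm_inv] at hnorm
    have := (one_lt_inv₀ hα.1).mpr hα.2
    linarith [hβ.2]

theorem evalAt_newton_eq_zero {n : ℕ} {q : ℂ} (hq : q ≠ 0) {τ : Fin n → ℂ} (hτ : τ ∈ paramSet n)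
    {α β : Fin n → ℤ} {i : Fin n} (hα : ∀ l, stage (α l) l ≠ stage (β i) i)
    (hlt : ∀ s < stage (β i) i, (∃ l, stage (α l) l = s) ↔ ∃ l, stage (β l) l = s) :
    evalAt (interpPoint q τ β) (newton q τ α) = 0 := by
  rw [evalAt_newton q τ α (interpPoint_ne_zero hq hτ β)]
  -- Were (α_i, i) listed before (β_i, i), β would contain it too, forcing α_i = β_i.
  have hmem : β i ∈ before (α i) := by
    rw [mem_before_iff i]
    by_contra h
    have h' := lt_of_le_of_ne (not_lt.mp h) (hα i)
    obtain ⟨l, hl⟩ := (hlt _ h').mp ⟨i, rfl⟩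
    obtain ⟨h1, rfl⟩ := stage_inj hl
    exact hα l (by rw [h1])
  refine Finset.prod_eq_zero (Finset.mem_univ i) (Finset.prod_eq_zero hmem ?_)
  -- Distinct indices occupy distinct stages, so the count depends only on the set of occupied
  -- stages, on which α and β agree so far.
  have hcount : countBefore α (stage (β i) i) = countBefore β (stage (β i) i) := by
    have key : ∀ γ : Fin n → ℤ, countBefore γ (stage (β i) i) =
        ((Finset.range (stage (β i) i)).filter fun s => ∃ l, stage (γ l) l = s).card := by
      intro γ
      rw [countBefore, ← Finset.card_image_of_injective _
        (f := fun l => stage (γ l) l) fun _ _ h => (stage_inj h).2]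
      congr 1
      ext s
      simp only [Finset.mem_image, Finset.mem_filter, Finset.mem_univ, true_and,
        Finset.mem_range]
      constructor
      · rintro ⟨l, hl, rfl⟩
        exact ⟨hl, l, rfl⟩
      · rintro ⟨hs, l, rfl⟩
        exact ⟨l, hs, rfl⟩
    rw [key, key]
    congr 1
    ext s
    simp only [Finset.mem_filter, Finset.mem_range]
    exact and_congr_right fun hs => hlt s hs
  rw [interpPoint_zpow_sgn, newtonNode, newtonNode, hcount, sub_self]

open Classical in
/-- The key by which the evaluations of the Newton polynomials are triangular. -/
def newtonKey {n : ℕ} (α : Fin n → ℤ) : Lex (ℕ → ℕ) :=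
  toLex fun s => if ∃ l, stage (α l) l = s then 0 else 1

theorem newtonKey_injective {n : ℕ} : Function.Injective (newtonKey (n := n)) := by
  intro α β h
  funext i
  have h' := congrFun (toLex.injective h) (stage (α i) i)
  rw [if_pos ⟨i, rfl⟩] at h'
  split_ifs at h' with h2
  obtain ⟨l, hl⟩ := h2
  obtain ⟨h3, rfl⟩ := stage_inj hl
  exact h3.symm

/-- Occupied stages carry 0, so the smaller key is the one occupied at the first difference; that
stage supplies the vanishing factor. -/
theorem evalAt_newton_of_lt {n : ℕ} {q : ℂ} (hq : q ≠ 0) {τ : Fin n → ℂ} (hτ : τ ∈ paramSet n)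
    {α β : Fin n → ℤ} (h : newtonKey β < newtonKey α) :
    evalAt (interpPoint q τ β) (newton q τ α) = 0 := by
  obtain ⟨s, hs, hlt⟩ := h
  simp only [newtonKey, Pi.toLex_apply] at hs hlt
  split_ifs at hlt with h1 h2
  · exact (lt_irrefl _ hlt).elim
  · obtain ⟨i, rfl⟩ := h1
    refine evalAt_newton_eq_zero hq hτ (i := i) (fun l hl => h2 ⟨l, hl⟩) fun t ht => ?_
    have := hs t ht
    split_ifs at this with h3 h4 h4 <;> simp_all
  all_goals omega

/-! ## Square linear systems -/

/-- An endomorphism of a finite-dimensional space is injective iff surjective. Values outside `s`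
play no role; unknowns on all of `ι` avoid subtypes in the applications. -/
theorem linear_system_unique_iff {ι : Type*} (s : Finset ι) (M : ι → ι → ℂ) :
    (∀ c : ι → ℂ, (∀ j ∈ s, ∑ i ∈ s, c i * M i j = 0) → ∀ i ∈ s, c i = 0) ↔
      ∀ v : ι → ℂ, ∃ c : ι → ℂ, ∀ j ∈ s, ∑ i ∈ s, c i * M i j = v j := by
  classical
  let L : (s → ℂ) →ₗ[ℂ] (s → ℂ) :=
    { toFun := fun c j => ∑ i, c i * M i j
      map_add' := fun c d => by
        funext j
        simp [add_mul, Finset.sum_add_distrib]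
      map_smul' := fun a c => by
        funext j
        simp [Finset.mul_sum, mul_assoc] }
  have hL : ∀ (c : ι → ℂ) (j : s), L (fun i => c i) j = ∑ i ∈ s, c i * M i j := fun c j =>
    Finset.sum_coe_sort s fun i => c i * M i j
  have ext : ∀ c : s → ℂ, ∃ c' : ι → ℂ, (fun i : s => c' i) = c := fun c =>
    ⟨fun i => if h : i ∈ s then c ⟨i, h⟩ else 0, by funext i; simp⟩
  have h1 : (∀ c : ι → ℂ, (∀ j ∈ s, ∑ i ∈ s, c i * M i j = 0) → ∀ i ∈ s, c i = 0) ↔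
      Function.Injective L := by
    rw [injective_iff_map_eq_zero]
    constructor
    · intro h c hc
      obtain ⟨c, rfl⟩ := ext c
      funext i
      exact h c (fun j hj => by rw [← hL c ⟨j, hj⟩, hc, Pi.zero_apply]) i i.2
    · intro h c hc i hi
      exact congrFun (h (fun i => c i) (funext fun j => by
        rw [hL, hc j j.2, Pi.zero_apply])) ⟨i, hi⟩
  have h2 : (∀ v : ι → ℂ, ∃ c : ι → ℂ, ∀ j ∈ s, ∑ i ∈ s, c i * M i j = v j) ↔
      Function.Surjective L := by
    constructor
    · intro h v
      obtain ⟨v, rfl⟩ := ext v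
      obtain ⟨c, hc⟩ := h v
      exact ⟨fun i => c i, funext fun j => by rw [hL, hc j j.2]⟩
    · intro h v
      obtain ⟨c, hc⟩ := h fun j => v j
      obtain ⟨c, rfl⟩ := ext c
      exact ⟨c, fun j hj => by rw [← hL c ⟨j, hj⟩, hc]⟩
  rw [h1, h2]
  exact LinearMap.injective_iff_surjective

/-! ## Nonsymmetric interpolation -/

section Interpolation

variable {n : ℕ} {q : ℂ} {τ : Fin n → ℂ}

theorem newton_unique (hq0 : 0 < ‖q‖) (hq1 : ‖q‖ < 1) (hτ : τ ∈ paramSet n)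
    (s : Finset (Fin n → ℤ)) (c : (Fin n → ℤ) → ℂ)
    (h : ∀ β ∈ s, ∑ α ∈ s, c α * evalAt (interpPoint q τ β) (newton q τ α) = 0) :
    ∀ α ∈ s, c α = 0 := by
  classical
  by_contra! hne
  obtain ⟨α₀, hα₀, hc₀⟩ := hne
  -- At the point of the α with minimal key among the nonzero coefficients, only its own term
  -- survives.
  obtain ⟨α, hα, hmin⟩ := (s.filter (c · ≠ 0)).exists_min_image newtonKey
    ⟨α₀, Finset.mem_filter.mpr ⟨hα₀, hc₀⟩⟩
  rw [Finset.mem_filter] at hα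
  have h1 := h α hα.1
  rw [Finset.sum_eq_single_of_mem α hα.1] at h1
  · exact mul_ne_zero hα.2 (evalAt_newton_self_ne_zero hq0 hq1 hτ α) h1
  · intro β hβ hne
    by_cases hcβ : c β = 0
    · rw [hcβ, zero_mul]
    · have hle := hmin β (Finset.mem_filter.mpr ⟨hβ, hcβ⟩)
      rw [evalAt_newton_of_lt (norm_pos_iff.mp hq0) hτ
        (lt_of_le_of_ne hle fun h' => hne (newtonKey_injective h').symm), mul_zero]

theorem exists_interpolation (hq0 : 0 < ‖q‖) (hq1 : ‖q‖ < 1) (hτ : τ ∈ paramSet n) (d : ℕ)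
    (v : (Fin n → ℤ) → ℂ) :
    ∃ g : Laurent n, DegreeLE d g ∧ ∀ β, weight β ≤ d → evalAt (interpPoint q τ β) g = v β := by
  obtain ⟨c, hc⟩ := (linear_system_unique_iff (weightLE n d)
    fun α β => evalAt (interpPoint q τ β) (newton q τ α)).mp
      (newton_unique hq0 hq1 hτ (weightLE n d)) v
  refine ⟨∑ α ∈ weightLE n d, c α • newton q τ α, ?_, fun β hβ => ?_⟩
  · exact mem_degreeLE.mp (sum_mem fun α hα => Submodule.smul_mem _ _
      ((degreeLE_newton q τ α).mono (mem_weightLE.mp hα)))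
  · simp only [evalAt_sum, evalAt_smul]
    exact hc β (mem_weightLE.mpr hβ)

theorem evalAt_eq_sum {d : ℕ} {f : Laurent n} (hf : DegreeLE d f) (x : Fin n → ℂ) :
    evalAt x f = ∑ α ∈ weightLE n d, f.coeff α * monomialAt x α := by
  conv_lhs => rw [eq_sum_single hf]
  simp only [evalAt_sum, evalAt_single]

/-- Solvability for all values makes the square evaluation matrix of the monomials surjective, hence
injective. -/
theorem eq_zero_of_evalAt_eq_zero (hq0 : 0 < ‖q‖) (hq1 : ‖q‖ < 1) (hτ : τ ∈ paramSet n)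
    {d : ℕ} {f : Laurent n} (hf : DegreeLE d f)
    (h : ∀ β, weight β ≤ d → evalAt (interpPoint q τ β) f = 0) : f = 0 := by
  have huniq := (linear_system_unique_iff (weightLE n d)
    fun α β => monomialAt (interpPoint q τ β) α).mpr fun v => by
      obtain ⟨g, hg, hgv⟩ := exists_interpolation hq0 hq1 hτ d v
      exact ⟨g.coeff, fun β hβ => by rw [← evalAt_eq_sum hg, hgv β (mem_weightLE.mp hβ)]⟩
  have hcoeff := huniq f.coeff fun β hβ => by
    rw [← evalAt_eq_sum hf, h β (mem_weightLE.mp hβ)]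
  rw [eq_sum_single hf]
  exact Finset.sum_eq_zero fun α hα => by rw [hcoeff α hα, AddMonoidAlgebra.single_zero]

theorem eq_of_evalAt_eq (hq0 : 0 < ‖q‖) (hq1 : ‖q‖ < 1) (hτ : τ ∈ paramSet n)
    {d : ℕ} {f g : Laurent n} (hf : DegreeLE d f) (hg : DegreeLE d g)
    (h : ∀ β, weight β ≤ d → evalAt (interpPoint q τ β) f = evalAt (interpPoint q τ β) g) :
    f = g :=
  sub_eq_zero.mp <| eq_zero_of_evalAt_eq_zero hq0 hq1 hτ
    ((degreeLE n d).sub_mem (mem_degreeLE.mpr hf) (mem_degreeLE.mpr hg))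
    fun β hβ => by rw [evalAt_sub, h β hβ, sub_self]

theorem existsUnique_isNonsymInterp (hq0 : 0 < ‖q‖) (hq1 : ‖q‖ < 1) (hτ : τ ∈ paramSet n)
    (α : Fin n → ℤ) : ∃! g, IsNonsymInterp q τ α g := by
  classical
  obtain ⟨g, hg, hgv⟩ := exists_interpolation hq0 hq1 hτ (weight α) (Pi.single α 1)
  refine ⟨g, ⟨hg, by rw [hgv α le_rfl, Pi.single_eq_same],
    fun β hβ hne => by rw [hgv β hβ, Pi.single_eq_of_ne hne]⟩, fun g' hg' => ?_⟩
  refine eq_of_evalAt_eq hq0 hq1 hτ hg'.1 hg fun β hβ => ?_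
  rw [hgv β hβ]
  by_cases hne : β = α
  · rw [hne, hg'.2.1, Pi.single_eq_same]
  · rw [hg'.2.2 β hβ hne, Pi.single_eq_of_ne hne]

theorem isNonsymInterp_nonsymInterp (hq0 : 0 < ‖q‖) (hq1 : ‖q‖ < 1) (hτ : τ ∈ paramSet n)
    (α : Fin n → ℤ) : IsNonsymInterp q τ α (nonsymInterp q τ α) :=
  Classical.epsilon_spec (existsUnique_isNonsymInterp hq0 hq1 hτ α).exists

/-! ## Symmetric interpolation -/

theorem weight_smul (w : WeylB n) (α : Fin n → ℤ) : weight (w • α) = weight α := by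
  simp only [weight, weyl_smul_apply]
  rw [← Equiv.sum_comp w.right.symm fun i => (α i).natAbs]
  refine Finset.sum_congr rfl fun i _ => ?_
  rcases Int.units_eq_one_or (w.left i) with hw | hw <;> simp [hw]

theorem weight_of_mem_orbit {α β : Fin n → ℤ} (h : β ∈ MulAction.orbit (WeylB n) α) :
    weight β = weight α := by
  obtain ⟨w, rfl⟩ := h
  exact weight_smul w α

theorem weight_domRep (α : Fin n → ℤ) : weight (domRep α) = weight α :=
  weight_of_mem_orbit (domRep_mem_orbit α)

theorem mem_orbitFinset {α β : Fin n → ℤ} :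
    β ∈ orbitFinset α ↔ β ∈ MulAction.orbit (WeylB n) α := by
  simp [orbitFinset]

theorem mem_orbitFinset_iff_domRep_eq {lam β : Fin n → ℤ} (hlam : IsPartition lam) :
    β ∈ orbitFinset lam ↔ domRep β = lam := by
  rw [mem_orbitFinset, MulAction.mem_orbit_symm]
  constructor
  · intro h
    exact (eq_domRep_of_mem_orbit β lam hlam h).symm
  · rintro rfl
    exact domRep_mem_orbit β

theorem domRep_of_isPartition {μ : Fin n → ℤ} (hμ : IsPartition μ) : domRep μ = μ :=
  (eq_domRep_of_mem_orbit μ μ hμ (MulAction.mem_orbit_self μ)).symm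

/-- Inverting and permuting the coordinates of `x` amounts to acting on exponents. -/
theorem exists_monomialAt_interpPoint (q : ℂ) (τ : Fin n → ℂ) (α : Fin n → ℤ) :
    ∃ w : WeylB n, ∀ γ : Fin n → ℤ, monomialAt (interpPoint q τ α) γ =
      monomialAt (interpPoint q τ (domRep α)) (w • γ) := by
  -- The signed permutation that carries α to α⁺ in `domRep_mem_orbit`.
  refine ⟨⟨fun j => if 0 ≤ α (sortPerm α j) then 1 else -1, (sortPerm α).symm⟩, fun γ => ?_⟩
  rw [monomialAt, ← Equiv.prod_comp (sortPerm α)]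
  refine Finset.prod_congr rfl fun j _ => ?_
  rw [interpPoint_of_isPartition q τ (isPartition_domRep α), interpPoint_apply, ← zpow_mul,
    weyl_smul_apply, Equiv.symm_apply_apply, domRep, Int.abs_eq_natAbs, zpow_natCast]
  congr 1
  simp only [sgn, Equiv.symm_symm]
  split_ifs <;> simp

theorem evalAt_interpPoint_of_isSymmetric {f : Laurent n} (hf : IsSymmetric f)
    (q : ℂ) (τ : Fin n → ℂ) (α : Fin n → ℤ) :
    evalAt (interpPoint q τ α) f = evalAt (interpPoint q τ (domRep α)) f := by
  obtain ⟨w, hw⟩ := exists_monomialAt_interpPoint q τ α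
  conv_rhs => rw [← hf w]
  rw [evalAt_mapDomain, evalAt]
  simp only [hw]

theorem eq_of_isSymmetric (hq0 : 0 < ‖q‖) (hq1 : ‖q‖ < 1) (hτ : τ ∈ paramSet n)
    {d : ℕ} {f g : Laurent n} (hf : DegreeLE d f) (hg : DegreeLE d g) (hfs : IsSymmetric f)
    (hgs : IsSymmetric g) (h : ∀ μ, IsPartition μ → weight μ ≤ d →
      evalAt (interpPoint q τ μ) f = evalAt (interpPoint q τ μ) g) : f = g :=
  eq_of_evalAt_eq hq0 hq1 hτ hf hg fun β hβ => by
    rw [evalAt_interpPoint_of_isSymmetric hfs, evalAt_interpPoint_of_isSymmetric hgs]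
    exact h _ (isPartition_domRep β) ((weight_domRep β).trans_le hβ)

/-! ### Orbit sums and existence in the symmetric case -/

theorem isSymmetric_zero : IsSymmetric (0 : Laurent n) := fun _ =>
  AddMonoidAlgebra.mapDomain_zero _

theorem isSymmetric_add {f g : Laurent n} (hf : IsSymmetric f) (hg : IsSymmetric g) :
    IsSymmetric (f + g) := fun w => by
  rw [AddMonoidAlgebra.mapDomain_add, hf w, hg w]

theorem isSymmetric_smul {f : Laurent n} (c : ℂ) (hf : IsSymmetric f) :
    IsSymmetric (c • f) := fun w => by
  conv_rhs => rw [← hf w]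
  exact congrArg AddMonoidAlgebra.ofCoeff (Finsupp.mapDomain_smul c f.coeff)

/-- The sum of the monomials in the orbit of `α`. -/
def orbitSum (α : Fin n → ℤ) : Laurent n :=
  ∑ β ∈ orbitFinset α, AddMonoidAlgebra.single β 1

theorem isSymmetric_orbitSum (α : Fin n → ℤ) : IsSymmetric (orbitSum α) := by
  intro w
  have h : AddMonoidAlgebra.mapDomain (fun β : Fin n → ℤ => w • β) (orbitSum α) =
      ∑ β ∈ orbitFinset α, AddMonoidAlgebra.single (w • β) 1 := by
    rw [orbitSum]
    refine AddMonoidAlgebra.ext ?_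
    rw [AddMonoidAlgebra.coeff_mapDomain, AddMonoidAlgebra.coeff_sum, Finsupp.mapDomain_finsetSum,
      AddMonoidAlgebra.coeff_sum]
    simp
  rw [h]
  refine Finset.sum_bij' (fun β _ => w • β) (fun β _ => w⁻¹ • β) ?_ ?_ ?_ ?_ ?_
  · intro β hβ
    rw [mem_orbitFinset] at hβ ⊢
    exact MulAction.mem_orbit_of_mem_orbit w hβ
  · intro β hβ
    rw [mem_orbitFinset] at hβ ⊢
    exact MulAction.mem_orbit_of_mem_orbit w⁻¹ hβ
  all_goals simp

theorem degreeLE_orbitSum (α : Fin n → ℤ) : DegreeLE (weight α) (orbitSum α) :=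
  mem_degreeLE.mp (sum_mem fun _ hβ => degreeLE_single
    (weight_of_mem_orbit (mem_orbitFinset.mp hβ)).le 1)

-- Each orbit contains exactly one partition, so the coefficients at partitions recover a
-- combination of orbit sums.
open Classical in
theorem coeff_orbitSum {lam μ : Fin n → ℤ} (hlam : IsPartition lam) (hμ : IsPartition μ) :
    (orbitSum lam).coeff μ = if μ = lam then 1 else 0 := by
  rw [orbitSum, AddMonoidAlgebra.coeff_sum, Finsupp.finsetSum_apply]
  simp only [AddMonoidAlgebra.coeff_single, Finsupp.single_apply, Finset.sum_ite_eq',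
    mem_orbitFinset_iff_domRep_eq hlam, domRep_of_isPartition hμ]

open Classical in
theorem exists_symmetric_interpolation (hq0 : 0 < ‖q‖) (hq1 : ‖q‖ < 1) (hτ : τ ∈ paramSet n)
    (d : ℕ) (v : (Fin n → ℤ) → ℂ) :
    ∃ f : Laurent n, IsSymmetric f ∧ DegreeLE d f ∧
      ∀ μ, IsPartition μ → weight μ ≤ d → evalAt (interpPoint q τ μ) f = v μ := by
  set s := (weightLE n d).filter IsPartition with hs
  have hmem : ∀ μ, μ ∈ s ↔ weight μ ≤ d ∧ IsPartition μ := fun μ => by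
    rw [hs, Finset.mem_filter, mem_weightLE]
  let F : ((Fin n → ℤ) → ℂ) → Laurent n := fun c => ∑ lam ∈ s, c lam • orbitSum lam
  have hsym : ∀ c, IsSymmetric (F c) := fun c =>
    Finset.sum_induction _ IsSymmetric (fun _ _ => isSymmetric_add) isSymmetric_zero
      fun lam _ => isSymmetric_smul _ (isSymmetric_orbitSum lam)
  have hdeg : ∀ c, DegreeLE d (F c) := fun c =>
    mem_degreeLE.mp (sum_mem fun lam hlam => Submodule.smul_mem _ _
      ((degreeLE_orbitSum lam).mono ((hmem lam).mp hlam).1))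
  have heval : ∀ c x, evalAt x (F c) = ∑ lam ∈ s, c lam * evalAt x (orbitSum lam) := fun c x => by
    simp only [F, evalAt_sum, evalAt_smul]
  -- Partitions index both the orbit sums and the points, so the system is square and uniqueness
  -- suffices.
  obtain ⟨c, hc⟩ := (linear_system_unique_iff s
    fun lam μ => evalAt (interpPoint q τ μ) (orbitSum lam)).mp (fun c hc μ hμ => by
      have h0 : F c = 0 := eq_of_isSymmetric hq0 hq1 hτ (hdeg c) (degreeLE n d).zero_mem
        (hsym c) isSymmetric_zero fun ν hν hw => by
          rw [heval, hc ν ((hmem ν).mpr ⟨hw, hν⟩)]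
          exact (map_zero (evalLin (interpPoint q τ ν))).symm
      have h1 : (F c).coeff μ = c μ := by
        rw [AddMonoidAlgebra.coeff_sum, Finsupp.finsetSum_apply,
          Finset.sum_eq_single_of_mem μ hμ]
        · rw [AddMonoidAlgebra.coeff_smul, Finsupp.smul_apply,
            coeff_orbitSum ((hmem μ).mp hμ).2 ((hmem μ).mp hμ).2, if_pos rfl, smul_eq_mul, mul_one]
        · intro lam hlam hne
          rw [AddMonoidAlgebra.coeff_smul, Finsupp.smul_apply,
            coeff_orbitSum ((hmem lam).mp hlam).2 ((hmem μ).mp hμ).2, if_neg hne.symm, smul_zero]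
      rw [← h1, h0]
      rfl) v
  exact ⟨F c, hsym c, hdeg c, fun μ hμ hw => by rw [heval, hc μ ((hmem μ).mpr ⟨hw, hμ⟩)]⟩

theorem existsUnique_isSymInterp (hq0 : 0 < ‖q‖) (hq1 : ‖q‖ < 1) (hτ : τ ∈ paramSet n)
    {lam : Fin n → ℤ} (hlam : IsPartition lam) : ∃! f, IsSymInterp q τ lam f := by
  classical
  obtain ⟨f, hfs, hf, hfv⟩ := exists_symmetric_interpolation hq0 hq1 hτ (weight lam)
    (Pi.single lam 1)
  refine ⟨f, ⟨hfs, hf, by rw [hfv lam hlam le_rfl, Pi.single_eq_same],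
    fun μ hμ hw hne => by rw [hfv μ hμ hw, Pi.single_eq_of_ne hne]⟩, fun g hg => ?_⟩
  refine eq_of_isSymmetric hq0 hq1 hτ hg.2.1 hf hg.1 hfs fun μ hμ hw => ?_
  rw [hfv μ hμ hw]
  by_cases hne : μ = lam
  · rw [hne, hg.2.2.1, Pi.single_eq_same]
  · rw [hg.2.2.2 μ hμ hw hne, Pi.single_eq_of_ne hne]

theorem isSymInterp_symInterp (hq0 : 0 < ‖q‖) (hq1 : ‖q‖ < 1) (hτ : τ ∈ paramSet n)
    {lam : Fin n → ℤ} (hlam : IsPartition lam) : IsSymInterp q τ lam (symInterp q τ lam) :=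
  Classical.epsilon_spec (existsUnique_isSymInterp hq0 hq1 hτ hlam).exists

theorem symInterp_eq_sum (hq0 : 0 < ‖q‖) (hq1 : ‖q‖ < 1) (hτ : τ ∈ paramSet n)
    {lam : Fin n → ℤ} (hlam : IsPartition lam) :
    symInterp q τ lam = ∑ β ∈ orbitFinset lam, nonsymInterp q τ β := by
  obtain ⟨hRs, hRd, hR1, hR0⟩ := isSymInterp_symInterp hq0 hq1 hτ hlam
  have hG := isNonsymInterp_nonsymInterp hq0 hq1 hτ
  have hw : ∀ β ∈ orbitFinset lam, weight β = weight lam := fun β hβ =>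
    weight_of_mem_orbit (mem_orbitFinset.mp hβ)
  refine eq_of_evalAt_eq hq0 hq1 hτ hRd (mem_degreeLE.mp (sum_mem fun β hβ =>
    (hG β).1.mono (hw β hβ).le)) fun α hα => ?_
  rw [evalAt_interpPoint_of_isSymmetric hRs, evalAt_sum]
  by_cases h : domRep α = lam
  · have hα' := (mem_orbitFinset_iff_domRep_eq hlam).mpr h
    rw [h, hR1, Finset.sum_eq_single_of_mem α hα', (hG α).2.1]
    exact fun β hβ hne => (hG β).2.2 α (hα.trans (hw β hβ).ge) hne.symm
  · rw [hR0 _ (isPartition_domRep α) ((weight_domRep α).trans_le hα) h]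
    refine (Finset.sum_eq_zero fun β hβ => (hG β).2.2 α (hα.trans (hw β hβ).ge) ?_).symm
    rintro rfl
    exact h ((mem_orbitFinset_iff_domRep_eq hlam).mp hβ)

end Interpolation

/-! ## The principal specialization -/

theorem principalSpec_mem_paramSet {n : ℕ} {s t : ℂ} (hs0 : 0 < ‖s‖) (hs1 : ‖s‖ < 1)
    (ht : 1 < n → 0 < ‖t‖ ∧ ‖t‖ < 1) : principalSpec n s t ∈ paramSet n := by
  have hnorm : ∀ i, ‖principalSpec n s t i‖ = ‖s‖ * ‖t‖ ^ (n - 1 - (i : ℕ)) := fun i => by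
    rw [principalSpec, norm_mul, norm_pow]
  have hpow : ∀ k, k < n → 0 < ‖t‖ ^ k ∧ ‖t‖ ^ k ≤ 1 := fun k hk => by
    -- For n = 1 nothing is assumed on t, but only t^0 = 1 occurs.
    rcases Nat.eq_zero_or_pos k with rfl | hk0
    · simp
    · obtain ⟨h0, h1⟩ := ht (by omega)
      exact ⟨pow_pos h0 k, pow_le_one₀ h0.le h1.le⟩
  have hp : ∀ i : Fin n, 0 < ‖t‖ ^ (n - 1 - (i : ℕ)) ∧ ‖t‖ ^ (n - 1 - (i : ℕ)) ≤ 1 := fun i =>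
    hpow _ (by omega)
  refine ⟨fun i => ?_, fun i j hij => ?_, fun i => ?_⟩
  · rw [hnorm]
    exact mul_pos hs0 (hp i).1
  · simp only [hnorm]
    have hij' : (i : ℕ) < j := hij
    obtain ⟨h0, h1⟩ := ht (by omega)
    exact mul_lt_mul_of_pos_left (pow_lt_pow_right_of_lt_one₀ h0 h1 (by omega)) hs0
  · rw [hnorm]
    exact (mul_le_of_le_one_right hs0.le (hp i).2).trans_lt hs1

theorem coeff_rescale {n : ℕ} (c : Fin n → ℂ) (f : Laurent n) (α : Fin n → ℤ) :
    (rescale c f).coeff α = f.coeff α * monomialAt c α := by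
  classical
  rw [rescale, AddMonoidAlgebra.coeff_finsuppSum, Finsupp.sum_apply]
  simp only [AddMonoidAlgebra.coeff_single, Finsupp.single_apply]
  rw [Finsupp.sum, Finset.sum_ite_eq']
  split_ifs with h
  · rfl
  · rw [Finsupp.notMem_support_iff.mp h, zero_mul]

theorem evalAt_rescale {n : ℕ} (x c : Fin n → ℂ) (f : Laurent n) :
    evalAt x (rescale c f) = evalAt (fun i => c i * x i) f := by
  rw [rescale, Finsupp.sum, evalAt_sum, evalAt, Finsupp.sum]
  simp only [evalAt_single, monomialAt_mul, mul_assoc]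

theorem DegreeLE.rescale {n d : ℕ} {f : Laurent n} (hf : DegreeLE d f) (c : Fin n → ℂ) :
    DegreeLE d (rescale c f) := fun α hα =>
  hf α fun h => hα (by rw [coeff_rescale, h, zero_mul])

theorem rescale_inv_rescale {n : ℕ} {c : Fin n → ℂ} (hc : ∀ i, c i ≠ 0) (f : Laurent n) :
    rescale (fun i => (c i)⁻¹) (rescale c f) = f := by
  refine AddMonoidAlgebra.ext (Finsupp.ext fun α => ?_)
  rw [coeff_rescale, coeff_rescale, mul_assoc, ← monomialAt_mul]
  simp [hc, monomialAt]

/-- At a partition every sign is + and π_μ is trivial, so dividing by τ turns the interpolation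
point into q^μ. This translates Okounkov's vanishing conditions into those of R_λ. -/
theorem evalAt_rescale_inv_interpPoint {n : ℕ} (q : ℂ) {τ : Fin n → ℂ} (hτ : ∀ i, τ i ≠ 0)
    {μ : Fin n → ℤ} (hμ : IsPartition μ) (P : Laurent n) :
    evalAt (interpPoint q τ μ) (rescale (fun i => (τ i)⁻¹) P) =
      evalAt (fun i => q ^ μ i) P := by
  rw [evalAt_rescale]
  congr 1
  funext i
  rw [interpPoint_of_isPartition q τ hμ, mul_comm (q ^ μ i), inv_mul_cancel_left₀ (hτ i)]

theorem exists_isOkounkov {n : ℕ} {q s t : ℂ} (hq0 : 0 < ‖q‖) (hq1 : ‖q‖ < 1)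
    (hτ : principalSpec n s t ∈ paramSet n) {lam : Fin n → ℤ} (hlam : IsPartition lam) :
    ∃ P, IsOkounkov q s t lam P := by
  obtain ⟨hs, hd, h1, h0⟩ := isSymInterp_symInterp hq0 hq1 hτ hlam
  have hne := param_ne_zero hτ
  refine ⟨rescale (principalSpec n s t) (symInterp q (principalSpec n s t) lam),
    hd.rescale _, ?_, ?_, fun μ hμ hw hμl => ?_⟩
  · rwa [rescale_inv_rescale hne]
  · rw [← evalAt_rescale_inv_interpPoint q hne hlam, rescale_inv_rescale hne, h1]
    exact one_ne_zero
  · rw [← evalAt_rescale_inv_interpPoint q hne hμ, rescale_inv_rescale hne, h0 μ hμ hw hμl]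

theorem rescale_eq_smul_symInterp {n : ℕ} {q s t : ℂ} (hq0 : 0 < ‖q‖) (hq1 : ‖q‖ < 1)
    (hτ : principalSpec n s t ∈ paramSet n) {lam : Fin n → ℤ} (hlam : IsPartition lam)
    {P : Laurent n} (hP : IsOkounkov q s t lam P) :
    rescale (fun i => (principalSpec n s t i)⁻¹) P =
      evalAt (fun i => q ^ lam i) P • symInterp q (principalSpec n s t) lam := by
  obtain ⟨hs, hd, h1, h0⟩ := isSymInterp_symInterp hq0 hq1 hτ hlam
  refine eq_of_isSymmetric hq0 hq1 hτ (hP.1.rescale _)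
    ((degreeLE n _).smul_mem _ (mem_degreeLE.mpr hd)) hP.2.1 (isSymmetric_smul _ hs)
    fun μ hμ hw => ?_
  rw [evalAt_rescale_inv_interpPoint q (param_ne_zero hτ) hμ, evalAt_smul]
  by_cases hne : μ = lam
  · rw [hne, h1, mul_one]
  · rw [hP.2.2.2 μ hμ hw hne, h0 μ hμ hw hne, mul_zero]

end BCInterp

end

theorem mainTheorem2 (n : ℕ) (hn : 0 < n) (q : ℂ) (hq0 : 0 < ‖q‖) (hq1 : ‖q‖ < 1) :
    (∀ τ ∈ paramSet n,
      (∀ lam : Fin n → ℤ, IsPartition lam → ∃! f, IsSymInterp q τ lam f) ∧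
      (∀ α : Fin n → ℤ, ∃! g, IsNonsymInterp q τ α g) ∧
      (∀ lam : Fin n → ℤ, IsPartition lam → ∀ α : Fin n → ℤ,
        evalAt (interpPoint q τ α) (symInterp q τ lam) =
          evalAt (interpPoint q τ (domRep α)) (symInterp q τ lam)) ∧
      (∀ lam : Fin n → ℤ, IsPartition lam →
        symInterp q τ lam = ∑ β ∈ orbitFinset lam, nonsymInterp q τ β)) ∧
    (∀ s t : ℂ, 0 < ‖s‖ → ‖s‖ < 1 → (1 < n → 0 < ‖t‖ ∧ ‖t‖ < 1) →
      principalSpec n s t ∈ paramSet n ∧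
      ∀ lam : Fin n → ℤ, IsPartition lam →
        symInterp q (principalSpec n s t) lam =
          ∑ β ∈ orbitFinset lam, nonsymInterp q (principalSpec n s t) β ∧
        (∃ P, IsOkounkov q s t lam P) ∧
        ∀ P, IsOkounkov q s t lam P →
          rescale (fun i => (principalSpec n s t i)⁻¹) P =
            evalAt (fun i => q ^ lam i) P •
              ∑ β ∈ orbitFinset lam, nonsymInterp q (principalSpec n s t) β) := by
  refine ⟨fun τ hτ => ⟨fun lam hlam => existsUnique_isSymInterp hq0 hq1 hτ hlam,
    existsUnique_isNonsymInterp hq0 hq1 hτ,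
    fun lam hlam α =>
      evalAt_interpPoint_of_isSymmetric (isSymInterp_symInterp hq0 hq1 hτ hlam).1 q τ α,
    fun lam hlam => symInterp_eq_sum hq0 hq1 hτ hlam⟩, fun s t hs0 hs1 ht => ?_⟩
  have hτ := principalSpec_mem_paramSet hs0 hs1 ht
  refine ⟨hτ, fun lam hlam => ⟨symInterp_eq_sum hq0 hq1 hτ hlam,
    exists_isOkounkov hq0 hq1 hτ hlam, fun P hP => ?_⟩⟩
  rw [← symInterp_eq_sum hq0 hq1 hτ hlam]
  exact rescale_eq_smul_symInterp hq0 hq1 hτ hlam hP
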